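/- For complex numbers $a,q$ with $|q|<1$ write $(a;q)_n=\prod_{m=0}^{n-1}(1-aq^m)$ for $n\ge 0$ and $(a;q)_\infty=\prod_{m=0}^{\infty}(1-aq^m)$, and let $$\nu(\alpha,z;q)=\sum_{n=0}^{\infty}\frac{\alpha^n q^{n^2+n}}{(-zq;q^2)_{n+1}}$$ whenever no denominator vanishes. **Theorem.** Let $q,\alpha,z\in\mathbb{C}$ with $|q|<1$, $\alpha\neq0$, $z\neq 0$, and suppose that $-zq^{m+1}/\alpha\neq1$ and $-\alpha^2q^{2m+1}/z\neq1$ for all integers $m\ge0$. Then all the series below converge, and $$\sum_{n=0}^{\infty}\frac{(-zq;q)_{2n}\,(-zq^{2n+2};q^2)_\infty}{(-zq/\alpha;q)_n}\,q^n=-\frac{\alpha}{z}\,\frac{(-zq;q)_\infty}{(-zq/\alpha;q)_\infty}\,\nu\!\left(\frac{\alpha^2}{z},-\frac{\alpha^2}{z};-q\right)+(-zq^2;q^2)_\infty\sum_{n=0}^{\infty}\frac{(-\alpha/z;q)_{n+1}\,\alpha^n q^{n(n+1)/2}}{(-\alpha^2q/z;q^2)_{n+1}}.$$ -/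

import Mathlib

/-- The finite `q`-shifted factorial `(a; q)_n = ∏_{m=0}^{n-1} (1 - a q^m)`. -/
noncomputable def qPoch (a q : ℂ) (n : ℕ) : ℂ :=
  ∏ m ∈ Finset.range n, (1 - a * q ^ m)

/-- The infinite `q`-shifted factorial `(a; q)_∞ = ∏_{m=0}^∞ (1 - a q^m)`, used for `|q| < 1`. -/
noncomputable def qPochInf (a q : ℂ) : ℂ :=
  ∏' m : ℕ, (1 - a * q ^ m)

/-- For `|q| < 1` the infinite `q`-shifted factorial is the limit of the finite ones. -/
theorem tendsto_qPoch (a q : ℂ) (hq : ‖q‖ < 1) :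
    Filter.Tendsto (fun n : ℕ => qPoch a q n) Filter.atTop (nhds (qPochInf a q)) := by
  have hs : Summable fun m : ℕ => ‖-(a * q ^ m)‖ := by
    simp only [norm_neg, norm_mul, norm_pow]
    exact (summable_geometric_of_lt_one (norm_nonneg q) hq).mul_left ‖a‖
  have hm : Multipliable fun m : ℕ => 1 - a * q ^ m := by
    simpa [sub_eq_add_neg] using multipliable_one_add_of_summable hs
  exact hm.hasProd.tendsto_prod_nat

/-- The `n`-th term `α^n q^{n^2+n} / (-zq; q^2)_{n+1}` of the series `ν(α, z; q)`. -/
noncomputable def nuTerm (α z q : ℂ) (n : ℕ) : ℂ :=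
  α ^ n * q ^ (n ^ 2 + n) / qPoch (-z * q) (q ^ 2) (n + 1)

/-- The trivariate mock theta function
`ν(α, z; q) = ∑_{n=0}^∞ α^n q^{n^2+n} / (-zq; q^2)_{n+1}`. -/
noncomputable def nu (α z q : ℂ) : ℂ :=
  ∑' n : ℕ, nuTerm α z q n

open Filter Topology Finset

/-! Put β = α/z and c = -zq/α, so cβ = -q and αc = -zq. Replace (-β;q)_{n+1} in the last series by
∏_{m≤n} (t + βq^m) and call the sum F(t). Then F(1) is that series and F(0) is β times the ν-series.
Telescoping (`tsum_deformedTerm_recurrence`) gives F(t) = t + (1 - αct²)/(1 - ct) · F(tq) when ct ≠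
1. Iterating from t = 1 along t = q^N produces the left-hand sum, and F(q^N) → F(0) by dominated
convergence (`hasSum_qPoch_div_qPoch`). Multiplying by (-zq²;q²)_∞ finishes. -/

theorem qPoch_succ (a q : ℂ) (n : ℕ) : qPoch a q (n + 1) = qPoch a q n * (1 - a * q ^ n) :=
  prod_range_succ _ _

theorem qPoch_add (a q : ℂ) (n k : ℕ) :
    qPoch a q (n + k) = qPoch a q n * qPoch (a * q ^ n) q k := by
  simp only [qPoch, prod_range_add, pow_add, mul_assoc]

theorem norm_sq_lt_one {q : ℂ} (hq : ‖q‖ < 1) : ‖q ^ 2‖ < 1 := by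
  rw [norm_pow]
  exact pow_lt_one₀ (norm_nonneg q) hq two_ne_zero

theorem qPoch_mul_qPochInf (a : ℂ) {q : ℂ} (hq : ‖q‖ < 1) (n : ℕ) :
    qPoch a q n * qPochInf (a * q ^ n) q = qPochInf a q := by
  have h₁ := (tendsto_qPoch (a * q ^ n) q hq).const_mul (qPoch a q n)
  have h₂ := (tendsto_qPoch a q hq).comp (tendsto_add_atTop_nat n)
  refine tendsto_nhds_unique (h₁.congr fun k => ?_) h₂
  rw [Function.comp_apply, add_comm k n, qPoch_add]

theorem qPoch_two_mul (a q : ℂ) (n : ℕ) :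
    qPoch a q (2 * n) = qPoch a (q ^ 2) n * qPoch (a * q) (q ^ 2) n := by
  induction n with
  | zero => simp [qPoch]
  | succ n ih =>
    rw [show 2 * (n + 1) = 2 * n + 1 + 1 by ring, qPoch_succ, qPoch_succ, ih, qPoch_succ,
      qPoch_succ]
    ring

theorem qPochInf_split (a : ℂ) {q : ℂ} (hq : ‖q‖ < 1) :
    qPochInf a q = qPochInf a (q ^ 2) * qPochInf (a * q) (q ^ 2) := by
  have hq2 := norm_sq_lt_one hq
  have h₁ := (tendsto_qPoch a q hq).comp (tendsto_id.const_mul_atTop' (r := 2) two_pos)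
  refine tendsto_nhds_unique h₁
    (((tendsto_qPoch a _ hq2).mul (tendsto_qPoch (a * q) _ hq2)).congr fun n => ?_)
  exact (qPoch_two_mul a q n).symm

theorem qPoch_ne_zero {a q : ℂ} (h : ∀ m : ℕ, 1 - a * q ^ m ≠ 0) (n : ℕ) : qPoch a q n ≠ 0 :=
  prod_ne_zero_iff.mpr fun m _ => h m

theorem qPochInf_ne_zero {a q : ℂ} (hq : ‖q‖ < 1) (h : ∀ m : ℕ, 1 - a * q ^ m ≠ 0) :
    qPochInf a q ≠ 0 := by
  have hs : Summable fun m : ℕ => ‖-(a * q ^ m)‖ := by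
    simp only [norm_neg, norm_mul, norm_pow]
    exact (summable_geometric_of_lt_one (norm_nonneg q) hq).mul_left ‖a‖
  have := tprod_one_add_ne_zero_of_summable (f := fun m : ℕ => -(a * q ^ m))
    (by simpa [← sub_eq_add_neg] using h) hs
  simpa [qPochInf, ← sub_eq_add_neg] using this

theorem exists_norm_inv_qPoch_le {a q : ℂ} (hq : ‖q‖ < 1) (h : ∀ m : ℕ, 1 - a * q ^ m ≠ 0) :
    ∃ C : ℝ, ∀ n, ‖(qPoch a q n)⁻¹‖ ≤ C := by
  obtain ⟨C, hC⟩ := ((tendsto_qPoch a q hq).inv₀ (qPochInf_ne_zero hq h)).norm.bddAbove_range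
  exact ⟨C, fun n => hC ⟨n, rfl⟩⟩

theorem succ_triangle (n : ℕ) : (n + 1) * (n + 1 + 1) / 2 = n * (n + 1) / 2 + (n + 1) := by
  rw [show (n + 1) * (n + 1 + 1) = n * (n + 1) + (n + 1) * 2 by ring,
    Nat.add_mul_div_right _ _ two_pos]

theorem triangle_add_triangle (n : ℕ) : n * (n + 1) / 2 + n * (n + 1) / 2 = n ^ 2 + n := by
  have := Nat.div_mul_cancel (Nat.even_mul_succ_self n).two_dvd
  nlinarith

/-- Gaussian decay beats geometric growth. -/
theorem summable_pow_mul_pow_triangle {r : ℝ} (R : ℝ) (hr₀ : 0 ≤ r) (hr₁ : r < 1) :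
    Summable fun n : ℕ => R ^ n * r ^ (n * (n + 1) / 2) := by
  refine summable_of_ratio_norm_eventually_le (r := 1 / 2) (by norm_num) ?_
  have ht : Tendsto (fun n : ℕ => |R| * r ^ (n + 1)) atTop (𝓝 (|R| * 0)) :=
    ((tendsto_pow_atTop_nhds_zero_of_lt_one hr₀ hr₁).comp (tendsto_add_atTop_nat 1)).const_mul _
  rw [mul_zero] at ht
  filter_upwards [ht.eventually_le_const (show (0 : ℝ) < 1 / 2 by norm_num)] with n hn
  rw [succ_triangle]
  simp only [norm_mul, norm_pow, Real.norm_eq_abs, abs_of_nonneg hr₀]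
  calc |R| ^ (n + 1) * r ^ (n * (n + 1) / 2 + (n + 1))
      = |R| * r ^ (n + 1) * (|R| ^ n * r ^ (n * (n + 1) / 2)) := by ring
    _ ≤ _ := by gcongr

/-- The homogenized factorial `∏_{m<n} (t + β q^m)`. -/
noncomputable def homPoch (β q t : ℂ) (n : ℕ) : ℂ :=
  ∏ m ∈ range n, (t + β * q ^ m)

theorem homPoch_succ (β q t : ℂ) (n : ℕ) :
    homPoch β q t (n + 1) = homPoch β q t n * (t + β * q ^ n) :=
  prod_range_succ _ _

/-- Each factor after the first satisfies tq + βq^{m+1} = q(t + βq^m), so the products at tq and at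
t are directly comparable. -/
theorem homPoch_mul_succ (β q t : ℂ) (n : ℕ) :
    homPoch β q (t * q) (n + 1) = (t * q + β) * q ^ n * homPoch β q t n := by
  induction n with
  | zero => simp [homPoch]
  | succ n ih => rw [homPoch_succ, ih, homPoch_succ]; ring

theorem homPoch_zero_succ (β q : ℂ) (n : ℕ) :
    homPoch β q 0 (n + 1) = β * (β ^ n * q ^ (n * (n + 1) / 2)) := by
  induction n with
  | zero => simp [homPoch]
  | succ n ih => rw [homPoch_succ, ih, succ_triangle]; ring

theorem norm_homPoch_le {β q t : ℂ} (hq : ‖q‖ < 1) (ht : ‖t‖ ≤ 1) (n : ℕ) :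
    ‖homPoch β q t n‖ ≤ (1 + ‖β‖) ^ n := by
  rw [homPoch, norm_prod]
  refine (prod_le_prod (fun _ _ => norm_nonneg _) fun m _ => ?_).trans_eq
    (by rw [prod_const, card_range])
  refine (norm_add_le _ _).trans (add_le_add ht ?_)
  rw [norm_mul, norm_pow]
  exact mul_le_of_le_one_right (norm_nonneg β) (pow_le_one₀ (norm_nonneg q) hq.le)

theorem tendsto_homPoch (β q : ℂ) {u : ℕ → ℂ} (hu : Tendsto u atTop (𝓝 0)) (n : ℕ) :
    Tendsto (fun N => homPoch β q (u N) n) atTop (𝓝 (homPoch β q 0 n)) :=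
  tendsto_finsetProd _ fun _ _ => hu.add_const _

/-- The summand of the deformed series interpolating between the two series on the right-hand
side of the theorem (at `t = 1` and `t = 0`). -/
noncomputable def deformedTerm (α β q t : ℂ) (n : ℕ) : ℂ :=
  homPoch β q t (n + 1) * α ^ n * q ^ (n * (n + 1) / 2) / qPoch (-α * β * q) (q ^ 2) (n + 1)

section

variable {α β q : ℂ}

/-- The majorant does not depend on t, as the limit t = q^N → 0 requires. -/
theorem exists_norm_deformedTerm_le (hq : ‖q‖ < 1)
    (h : ∀ m : ℕ, 1 - (-α * β * q) * (q ^ 2) ^ m ≠ 0) :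
    ∃ b : ℕ → ℝ, Summable b ∧ ∀ t : ℂ, ‖t‖ ≤ 1 → ∀ n, ‖deformedTerm α β q t n‖ ≤ b n := by
  obtain ⟨C, hC⟩ := exists_norm_inv_qPoch_le (norm_sq_lt_one hq) h
  refine ⟨fun n => (1 + ‖β‖) * C *
    (((1 + ‖β‖) * ‖α‖) ^ n * ‖q‖ ^ (n * (n + 1) / 2)),
    (summable_pow_mul_pow_triangle _ (norm_nonneg q) hq).mul_left _, fun t ht n => ?_⟩
  rw [deformedTerm, div_eq_mul_inv, norm_mul, norm_mul, norm_mul, norm_pow, norm_pow]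
  calc _ ≤ (1 + ‖β‖) ^ (n + 1) * ‖α‖ ^ n * ‖q‖ ^ (n * (n + 1) / 2) * C := by
        gcongr
        · exact norm_homPoch_le hq ht _
        · exact hC _
    _ = _ := by simp only [mul_pow]; ring

theorem summable_deformedTerm (hq : ‖q‖ < 1)
    (h : ∀ m : ℕ, 1 - (-α * β * q) * (q ^ 2) ^ m ≠ 0) {t : ℂ} (ht : ‖t‖ ≤ 1) :
    Summable (deformedTerm α β q t) := by
  obtain ⟨b, hb, hle⟩ := exists_norm_deformedTerm_le hq h
  exact hb.of_norm_bounded (hle t ht)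

theorem tendsto_tsum_deformedTerm (hq : ‖q‖ < 1)
    (h : ∀ m : ℕ, 1 - (-α * β * q) * (q ^ 2) ^ m ≠ 0) :
    Tendsto (fun N : ℕ => ∑' n, deformedTerm α β q (q ^ N) n) atTop
      (𝓝 (∑' n, deformedTerm α β q 0 n)) := by
  obtain ⟨b, hb, hle⟩ := exists_norm_deformedTerm_le hq h
  refine tendsto_tsum_of_dominated_convergence hb (fun n => ?_)
    (Eventually.of_forall fun N => hle _ ?_)
  · exact (((tendsto_homPoch β q (tendsto_pow_atTop_nhds_zero_of_norm_lt_one hq) _).mul_const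
      _).mul_const _).div_const _
  · rw [norm_pow]
    exact pow_le_one₀ (norm_nonneg q) hq.le

theorem tendsto_telescoping_term (hq : ‖q‖ < 1)
    (h : ∀ m : ℕ, 1 - (-α * β * q) * (q ^ 2) ^ m ≠ 0) {t : ℂ} (ht : ‖t‖ ≤ 1) :
    Tendsto (fun n => homPoch β q t n * α ^ n * q ^ (n * (n + 1) / 2) /
      qPoch (-α * β * q) (q ^ 2) n) atTop (𝓝 0) := by
  obtain ⟨C, hC⟩ := exists_norm_inv_qPoch_le (norm_sq_lt_one hq) h
  refine squeeze_zero_norm (a := fun n =>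
    C * (((1 + ‖β‖) * ‖α‖) ^ n * ‖q‖ ^ (n * (n + 1) / 2))) (fun n => ?_) ?_
  · rw [div_eq_mul_inv, norm_mul, norm_mul, norm_mul, norm_pow, norm_pow]
    calc _ ≤ (1 + ‖β‖) ^ n * ‖α‖ ^ n * ‖q‖ ^ (n * (n + 1) / 2) * C := by
          gcongr
          · exact norm_homPoch_le hq ht _
          · exact hC _
      _ = _ := by simp only [mul_pow]; ring
  · simpa using (summable_pow_mul_pow_triangle _ (norm_nonneg q) hq).tendsto_atTop_zero.const_mul C

/-- The first-order `q`-difference equation in `t` of the deformed series. -/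
theorem tsum_deformedTerm_recurrence (hq : ‖q‖ < 1)
    (h : ∀ m : ℕ, 1 - (-α * β * q) * (q ^ 2) ^ m ≠ 0) {c : ℂ} (hc : c * β = -q)
    {t : ℂ} (ht : ‖t‖ ≤ 1) :
    (1 - c * t) * (∑' n, deformedTerm α β q t n - t) =
      (1 - α * c * t ^ 2) * ∑' n, deformedTerm α β q (t * q) n := by
  set D : ℕ → ℂ := fun n => homPoch β q t n * α ^ n * q ^ (n * (n + 1) / 2) /
      qPoch (-α * β * q) (q ^ 2) n with hD
  have htq : ‖t * q‖ ≤ 1 := by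
    rw [norm_mul]
    exact mul_le_one₀ ht (norm_nonneg q) hq.le
  have hs := (summable_deformedTerm hq h ht).hasSum.mul_left (1 - c * t)
  have hs' := (summable_deformedTerm hq h htq).hasSum.mul_left (1 - α * c * t ^ 2)
  -- Since tq + β = β(1 - ct), the factor 1 - ct comes out of both terms, and what remains
  -- telescopes.
  have key : ∀ n, (1 - c * t) * deformedTerm α β q t n -
      (1 - α * c * t ^ 2) * deformedTerm α β q (t * q) n =
        (1 - c * t) * t * (D n - D (n + 1)) := by
    intro n
    have hP := qPoch_ne_zero h n
    have hn := h n
    have hfac : t * q + β = β * (1 - c * t) := by linear_combination t * hc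
    simp only [hD, deformedTerm]
    rw [homPoch_mul_succ, homPoch_succ, qPoch_succ, hfac, succ_triangle, pow_add q]
    obtain ⟨d, hd⟩ : ∃ d, d = 1 - -α * β * q * (q ^ 2) ^ n := ⟨_, rfl⟩
    rw [← hd] at hn ⊢
    have hd' : d = 1 + α * β * q * (q ^ n) ^ 2 := by rw [hd]; ring
    generalize homPoch β q t n = A
    generalize q ^ (n * (n + 1) / 2) = e
    generalize qPoch (-α * β * q) (q ^ 2) n = P at *
    rw [pow_succ q n]
    generalize q ^ n = x at *
    rw [show A * α ^ n * e / P = A * α ^ n * e * d / (P * d) by field_simp]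
    linear_combination (A * α ^ n * e * (1 - c * t) / (P * d)) * (α * t ^ 2 * x * hc - t * hd')
  have hsum := (hs.sub hs').tendsto_sum_nat
  simp only [key, ← mul_sum, sum_range_sub'] at hsum
  have h0 : D 0 = 1 := by simp [hD, homPoch, qPoch]
  have hlim := ((tendsto_telescoping_term hq h ht).const_sub (D 0)).const_mul ((1 - c * t) * t)
  have := tendsto_nhds_unique hsum hlim
  rw [h0] at this
  linear_combination this

/-- The identity of the theorem after removing the common factor `(-z q²; q²)_∞`. -/
theorem hasSum_qPoch_div_qPoch (hq : ‖q‖ < 1)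
    (h : ∀ m : ℕ, 1 - (-α * β * q) * (q ^ 2) ^ m ≠ 0) {c : ℂ} (hc : c * β = -q)
    (h' : ∀ m : ℕ, 1 - c * q ^ m ≠ 0) :
    HasSum (fun n : ℕ => qPoch (α * c) (q ^ 2) n / qPoch c q n * q ^ n)
      (∑' n, deformedTerm α β q 1 n -
        qPochInf (α * c) (q ^ 2) / qPochInf c q * ∑' n, deformedTerm α β q 0 n) := by
  have hP : Tendsto (fun n => qPoch (α * c) (q ^ 2) n / qPoch c q n) atTop
      (𝓝 (qPochInf (α * c) (q ^ 2) / qPochInf c q)) :=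
    (tendsto_qPoch _ _ (norm_sq_lt_one hq)).div (tendsto_qPoch _ _ hq) (qPochInf_ne_zero hq h')
  have hsummable : Summable fun n : ℕ => qPoch (α * c) (q ^ 2) n / qPoch c q n * q ^ n := by
    obtain ⟨C, hC⟩ := hP.norm.bddAbove_range
    refine ((summable_geometric_of_lt_one (norm_nonneg q) hq).mul_left C).of_norm_bounded
      fun n => ?_
    rw [norm_mul, norm_pow]
    gcongr
    exact hC ⟨n, rfl⟩
  rw [hsummable.hasSum_iff_tendsto_nat]
  -- The N-th partial sum is exactly F(1) - (αc;q²)_N/(c;q)_N · F(q^N), by induction with the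
  -- recurrence at t = q^N.
  refine ((hP.mul (tendsto_tsum_deformedTerm hq h)).const_sub _).congr fun N => ?_
  induction N with
  | zero => simp [qPoch]
  | succ N ih =>
    rw [sum_range_succ, ← ih]
    have hrec := tsum_deformedTerm_recurrence hq h hc (t := q ^ N)
      (by rw [norm_pow]; exact pow_le_one₀ (norm_nonneg q) hq.le)
    rw [← pow_succ] at hrec
    have e1 : (q ^ 2) ^ N = (q ^ N) ^ 2 := by rw [← pow_mul, ← pow_mul, mul_comm]
    have hN := h' N
    have hPN := qPoch_ne_zero h' N
    rw [qPoch_succ, qPoch_succ, e1]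
    field_simp
    linear_combination qPoch (α * c) (q ^ 2) N * hrec

end

theorem homPoch_one (β q : ℂ) (n : ℕ) : homPoch β q 1 n = qPoch (-β) q n := by
  simp [homPoch, qPoch]

/-- At t = 0 the product is a monomial whose triangular power of q doubles the one present; n² + n
is even, so the base -q is harmless. -/
theorem deformedTerm_zero (α β q : ℂ) (n : ℕ) :
    deformedTerm α β q 0 n = β * nuTerm (α * β) (-(α * β)) (-q) n := by
  rw [deformedTerm, nuTerm, homPoch_zero_succ, neg_sq,
    Even.neg_pow (by simpa [sq, mul_add] using Nat.even_mul_succ_self n),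
    ← triangle_add_triangle, pow_add, neg_neg, mul_neg, neg_mul, neg_mul, mul_pow]
  ring

theorem theorem1p3 (q α z : ℂ) (hq : ‖q‖ < 1) (hα : α ≠ 0) (hz : z ≠ 0)
    (hden₁ : ∀ m : ℕ, 1 - (-z * q / α) * q ^ m ≠ 0)
    (hden₂ : ∀ m : ℕ, 1 - (-α ^ 2 * q / z) * (q ^ 2) ^ m ≠ 0) :
    Summable (nuTerm (α ^ 2 / z) (-α ^ 2 / z) (-q)) ∧
    Summable (fun n : ℕ =>
      qPoch (-α / z) q (n + 1) * α ^ n * q ^ (n * (n + 1) / 2) /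
        qPoch (-α ^ 2 * q / z) (q ^ 2) (n + 1)) ∧
    HasSum (fun n : ℕ =>
      qPoch (-z * q) q (2 * n) * qPochInf (-z * q ^ (2 * n + 2)) (q ^ 2) /
        qPoch (-z * q / α) q n * q ^ n)
      (-(α / z) * (qPochInf (-z * q) q / qPochInf (-z * q / α) q) *
          nu (α ^ 2 / z) (-α ^ 2 / z) (-q) +
        qPochInf (-z * q ^ 2) (q ^ 2) *
          ∑' n : ℕ, qPoch (-α / z) q (n + 1) * α ^ n * q ^ (n * (n + 1) / 2) /
            qPoch (-α ^ 2 * q / z) (q ^ 2) (n + 1)) := by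
  have hv : -α ^ 2 * q / z = -α * (α / z) * q := by ring
  have hαβ : α ^ 2 / z = α * (α / z) := by ring
  have hαβ' : -α ^ 2 / z = -(α * (α / z)) := by ring
  have hβ : α / z ≠ 0 := div_ne_zero hα hz
  have hc : -z * q / α * (α / z) = -q := by field_simp
  have hw : α * (-z * q / α) = -z * q := by field_simp
  have h1 : (fun n : ℕ => qPoch (-α / z) q (n + 1) * α ^ n * q ^ (n * (n + 1) / 2) /
      qPoch (-α ^ 2 * q / z) (q ^ 2) (n + 1)) = deformedTerm α (α / z) q 1 := by
    funext n
    rw [deformedTerm, homPoch_one, hv, neg_div]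
  have h0 : deformedTerm α (α / z) q 0 =
      fun n => α / z * nuTerm (α ^ 2 / z) (-α ^ 2 / z) (-q) n := by
    funext n
    rw [deformedTerm_zero, hαβ, hαβ']
  rw [hv] at hden₂
  have hmain := (hasSum_qPoch_div_qPoch hq hden₂ hc hden₁).mul_left (qPochInf (-z * q ^ 2) (q ^ 2))
  refine ⟨?_, ?_, ?_⟩
  · have := summable_deformedTerm hq hden₂ (t := 0) (by simp)
    rw [h0] at this
    exact (summable_mul_left_iff hβ).mp this
  · rw [h1]
    exact summable_deformedTerm hq hden₂ (by simp)
  · have hsplit : qPochInf (-z * q) q =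
        qPochInf (-z * q) (q ^ 2) * qPochInf (-z * q ^ 2) (q ^ 2) := by
      rw [qPochInf_split _ hq, mul_assoc (-z), ← sq]
    rw [tsum_congr (congrFun h1), hsplit, nu]
    rw [h0, tsum_mul_left, hw] at hmain
    -- The even-indexed and odd-indexed factors of (-zq;q)_{2n} separate; the half (-zq²;q²)_n
    -- completes the infinite tail to (-zq²;q²)_∞.
    have hterm : ∀ n, qPoch (-z * q) q (2 * n) * qPochInf (-z * q ^ (2 * n + 2)) (q ^ 2) /
        qPoch (-z * q / α) q n * q ^ n = qPochInf (-z * q ^ 2) (q ^ 2) *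
          (qPoch (-z * q) (q ^ 2) n / qPoch (-z * q / α) q n * q ^ n) := by
      intro n
      rw [qPoch_two_mul, mul_assoc (-z) q q, ← sq,
        ← qPoch_mul_qPochInf (-z * q ^ 2) (norm_sq_lt_one hq) n,
        show -z * q ^ 2 * (q ^ 2) ^ n = -z * q ^ (2 * n + 2) by ring]
      ring
    rw [funext hterm]
    refine Eq.subst (motive := HasSum _) ?_ hmain
    ring
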